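/- **Setting.** A sequential game consists of a non-empty set $A$ of players, a rooted tree $T$ (finite or infinite, with arbitrary branching), a non-empty set $O$ of outcomes, a map $d$ assigning to each vertex the player who controls it, a map $v$ assigning an outcome to each play (a play is a maximal path from the root), and for each player $a$ a preference relation $\prec_a$ on $O$. A strategy profile $s$ chooses one outgoing edge at every non-leaf vertex; following these choices from the root yields the play induced by $s$, and $v(s)$ denotes its outcome. Player $a$ can lazily convert $s$ to $s'$ if every vertex $t$ with $s(t)\neq s'(t)$ satisfies $d(t)=a$ and lies on the play induced by $s'$. There is a lazy improvement step $s\rightharpoonup s'$ if for some player $a$, $a$ can lazily convert $s$ to $s'$ and $v(s)\prec_a v(s')$. The players have win/lose objectives with winning sets $(W_a)_{a\in A}$, where each $W_a$ is a set of plays, if for all plays $p,q$ and all $a$: $v(p)\prec_a v(q)$ iff $p\notin W_a$ and $q\in W_a$. The set of plays carries its usual topology, generated by the sets of all plays through a given vertex; a set is $\Delta^0_2$ if it is both a countable intersection of open sets and a countable union of closed sets. For an ordinal $\alpha$ and a topology on the set of strategy profiles, an $\alpha$-sequence of lazy improvement is a family $(s_\beta)_{\beta<\alpha}$ of profiles such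 that $s_\beta\rightharpoonup s_{\beta+1}$ whenever $\beta+1<\alpha$, and such that for every limit ordinal $\beta<\alpha$, every $\beta'<\beta$ and every neighbourhood $U$ of $s_\beta$ there is $\gamma$ with $\beta'<\gamma<\beta$ and $s_\gamma\in U$. **Theorem.** Let $g$ be a sequential game with finitely many players who have win/lose objectives, such that every winning set is $\Delta^0_2$. 1. If strategy profiles carry the topology of the metric in which $s\ne s'$ have distance $2^{-i}$, with $i$ maximal such that $s$ and $s'$ coincide at all vertices of depth at most $i$ (distance $2$ if they differ at the root), then for every ordinal $\alpha$ and every $\alpha$-sequence of lazy improvement in $g$, $\alpha$ is (at most) countable. 2. If the tree $T$ is countable, the same holds when strategy profiles carry the product topology (each set of outgoing edges being discrete). -/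

import Mathlib

open Set Topology

universe u v w x

namespace LazyGame

/-! A rooted tree (finite or infinite) is a prefix-closed set `T` of finite sequences of moves; the
root is the empty sequence and the children of a vertex `t` are the vertices `t ++ [b]`. -/

section Tree

variable {B : Type v} (T : Descriptive.tree B)

/-- The vertices of the tree. -/
abbrev Vertex : Type v := {t : List B // t ∈ T}

/-- A maximal path from the root, given by the set of vertices that it visits (so it is either
an infinite branch, or a finite path that ends in a leaf). -/
abbrev Play : Type v := {P : Set (Vertex T) // IsMaxChain (fun t t' : Vertex T => t.1 <+: t'.1) P}

/-- The vertices that have at least one outgoing edge. -/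
abbrev InternalVertex : Type v := {t : List B // t ∈ T ∧ ∃ b : B, t ++ [b] ∈ T}

/-- A strategy profile: the choice of one outgoing edge at every non-leaf vertex. (The strategy
of a player is the restriction of the profile to the vertices that she owns.) -/
abbrev Profile : Type v := ∀ t : InternalVertex T, {b : B // t.1 ++ [b] ∈ T}

variable {T}

/-- All edges on the way from the root to `t` are chosen by `s`. -/
def Follows (s : Profile T) (t : List B) : Prop :=
  ∀ (u : InternalVertex T) (b : B), u.1 ++ [b] <+: t → (s u).1 = b

theorem Follows.of_prefix {s : Profile T} {t t' : List B} (h : Follows s t') (h' : t <+: t') :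
    Follows s t := fun u b hub => h u b (hub.trans h')

theorem Follows.snoc {s : Profile T} {u : InternalVertex T} (h : Follows s u.1) :
    Follows s (u.1 ++ [(s u).1]) := by
  intro w b hw
  rcases List.prefix_concat_iff.1 hw with heq | hpre
  · obtain ⟨h1, h2⟩ := List.append_inj' heq rfl
    have : w = u := Subtype.ext h1
    subst this
    simpa using h2.symm
  · exact h w b hpre

theorem exists_deviation {s : Profile T} :
    ∀ t : List B, t ∈ T → ¬ Follows s t →
      ∃ (u : InternalVertex T) (b : B), Follows s u.1 ∧ u.1 ++ [b] <+: t ∧ (s u).1 ≠ b := by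
  intro t
  induction t using List.reverseRecOn with
  | nil =>
    intro _ h
    refine absurd ?_ h
    intro u b hub
    simp at hub
  | append_singleton l a ih =>
    intro ht h
    have hl : l ∈ T := Descriptive.Tree.mem_of_append ht
    by_cases hf : Follows s l
    · refine ⟨⟨l, hl, a, ht⟩, a, hf, List.prefix_rfl, fun hs => h ?_⟩
      have := hf.snoc (u := ⟨l, hl, a, ht⟩)
      rwa [hs] at this
    · obtain ⟨u, b, h1, h2, h3⟩ := ih hl hf
      exact ⟨u, b, h1, h2.trans (List.prefix_append _ _), h3⟩

theorem follows_chain {s : Profile T} {t t' : List B} (ht : t ∈ T) (h : Follows s t)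
    (h' : Follows s t') (hlen : t.length ≤ t'.length) : t <+: t' := by
  induction t using List.reverseRecOn with
  | nil => simp
  | append_singleton l a ih =>
    have hl : l ∈ T := Descriptive.Tree.mem_of_append ht
    simp only [List.length_append, List.length_singleton] at hlen
    obtain ⟨r, rfl⟩ := ih hl (h.of_prefix (List.prefix_append _ _)) (by omega)
    cases r with
    | nil => simp at hlen
    | cons c r =>
      have e1 := h ⟨l, hl, a, ht⟩ a List.prefix_rfl
      have e2 := h' ⟨l, hl, a, ht⟩ c ⟨r, by simp⟩
      refine ⟨r, ?_⟩
      rw [← e1, e2]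
      simp

/-- The play induced by a strategy profile: the maximal path obtained by following, from the root
on, the edges chosen by the profile. -/
def inducedPlay (s : Profile T) : Play T :=
  ⟨{t | Follows s t.1}, by
    constructor
    · intro t ht t' ht' _
      rcases le_total t.1.length t'.1.length with h | h
      · exact Or.inl (follows_chain t.2 ht ht' h)
      · exact Or.inr (follows_chain t'.2 ht' ht h)
    · intro c hc hsub
      refine Subset.antisymm hsub fun t htc => ?_
      by_contra hnf
      obtain ⟨u, b, h1, h2, h3⟩ := exists_deviation t.1 t.2 hnf
      have hmem : (⟨u.1 ++ [(s u).1], (s u).2⟩ : Vertex T) ∈ c := hsub h1.snoc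
      have key : ¬ (u.1 ++ [b] <+: u.1 ++ [(s u).1]) := by
        intro hp
        have := hp.eq_of_length (by simp)
        simp at this
        exact h3 this.symm
      have hne : (⟨u.1 ++ [(s u).1], (s u).2⟩ : Vertex T) ≠ t := by
        rintro rfl
        exact key h2
      rcases hc hmem htc hne with h | h
      · have := List.prefix_of_prefix_length_le h2 h (by simp)
        exact key this
      · exact key (h2.trans h)⟩

/-- The usual topology on plays, generated by the sets of all plays through a given vertex. It is
the topology of the metric for which two plays are at distance `2⁻ⁿ` if they separate at
depth `n`. -/
instance : TopologicalSpace (Play T) :=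
  TopologicalSpace.generateFrom {C | ∃ t : Vertex T, C = {p : Play T | t ∈ p.1}}

variable (T)

/-- The topology on strategy profiles of the metric `d'(s, s') = 2⁻ⁱ`, where `i` is maximal such
that `s` and `s'` coincide at all vertices of depth at most `i`: its basic open sets consist
of the profiles that coincide with a given profile at all vertices of depth at most `i`. -/
abbrev depthTopology : TopologicalSpace (Profile T) :=
  TopologicalSpace.generateFrom
    {C | ∃ (s : Profile T) (i : ℕ), C = {s' | ∀ t : InternalVertex T, t.1.length ≤ i → s' t = s t}}

/-- The topology of pointwise convergence on strategy profiles, i.e. the product topology, where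
the set of outgoing edges of each vertex is discrete. -/
abbrev pointwiseTopology : TopologicalSpace (Profile T) :=
  @Pi.topologicalSpace (InternalVertex T) (fun t => {b : B // t.1 ++ [b] ∈ T}) (fun _ => ⊥)

end Tree

/-- A sequential game with set of players `A` and set of outcomes `O`, on a rooted tree whose edges
are labelled by elements of `B`. -/
structure SequentialGame (A : Type u) (B : Type v) (O : Type w) where
  /-- the game tree -/
  tree : Descriptive.tree B
  /-- the tree has a root -/
  root_mem : [] ∈ tree
  /-- the player who controls a vertex -/
  owner : Vertex tree → A
  /-- the outcome of a play -/
  outcome : Play tree → O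
  /-- the preferences: `pref a o o'` says that player `a` prefers `o'` to `o` -/
  pref : A → O → O → Prop

namespace SequentialGame

variable {A : Type u} {B : Type v} {O : Type w} (g : SequentialGame A B O)

/-- Player `a` can lazily convert `s` into `s'`: wherever they differ, `a` is in control and the
vertex lies along the play induced by `s'`. -/
def LazyConv (a : A) (s s' : Profile g.tree) : Prop :=
  ∀ t : InternalVertex g.tree, s t ≠ s' t →
    g.owner ⟨t.1, t.2.1⟩ = a ∧ (⟨t.1, t.2.1⟩ : Vertex g.tree) ∈ (inducedPlay s').1

/-- Lazy improvement of player `a`. -/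
def LazyImprovementOf (a : A) (s s' : Profile g.tree) : Prop :=
  g.pref a (g.outcome (inducedPlay s)) (g.outcome (inducedPlay s')) ∧ g.LazyConv a s s'

/-- The (collective) lazy improvement relation. -/
def LazyImprovement (s s' : Profile g.tree) : Prop :=
  ∃ a : A, g.LazyImprovementOf a s s'

/-- The players have win/lose objectives with winning sets `W a`: a player prefers the outcome of
one play to that of another iff she wins the former and loses the latter. -/
def IsWinLose (W : A → Set (Play g.tree)) : Prop :=
  ∀ (a : A) (p q : Play g.tree), g.pref a (g.outcome p) (g.outcome q) ↔ p ∉ W a ∧ q ∈ W a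

end SequentialGame

/-- `Δ⁰₂` sets: countable intersections of open sets that are also countable unions of closed
sets. -/
def IsDeltaZeroTwo {X : Type u} [TopologicalSpace X] (S : Set X) : Prop :=
  (∃ U : ℕ → Set X, (∀ i, IsOpen (U i)) ∧ S = ⋂ i, U i) ∧
    ∃ C : ℕ → Set X, (∀ i, IsClosed (C i)) ∧ S = ⋃ i, C i

/-- `α`-sequences of a relation `r` on a space with topology `τ`: each element is `r`-related to its
successor, and at a limit ordinal `β` the element is an accumulation point of the previous ones,
in the sense that each of its neighbourhoods is visited cofinally often before `β`. -/
structure IsOrdinalSequence {S : Type u} (τ : TopologicalSpace S) (r : S → S → Prop)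
    (α : Ordinal.{x}) (s : Set.Iio α → S) : Prop where
  step : ∀ β γ : Set.Iio α, γ.1 = Order.succ β.1 → r (s β) (s γ)
  limit : ∀ β : Set.Iio α, Order.IsSuccLimit β.1 → ∀ β' : Set.Iio α, β' < β →
    ∀ U ∈ @nhds S τ (s β), ∃ γ : Set.Iio α, β' < γ ∧ γ < β ∧ s γ ∈ U

end LazyGame

/-!
A sequence of lazy improvement that is not countable restricts to one of length `ω₁`, and some
player `a` makes moves cofinally often in it, because there are finitely many players.

The potential behind the proof is a single proposition, attached to a player `a` and a vertex `t`:
the last vertex on the way to `t` at which the profile `s` turns away from `t` is owned by `a`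
(`LastDeviationOwnedBy`). A lazy conversion by another player leaves its truth value unchanged, and
a lazy conversion by `a` can make it true only by leading the induced play away from `t`, and false
only by leading the induced play to `t` (`lastDeviationOwnedBy_lazyConv`).

For `λ < ω₁` let `P` be the set of the plays that `a` leaves or reaches by her moves from time `λ`
on. Since her winning set is `Δ⁰₂`, a Baire category argument yields a vertex `t` lying on some play
of `P` such that `a` wins either all plays of `P` through `t` or none of them
(`exists_homogeneous_vertex`). If she loses them all, then her moves from `λ` on never enter the
plays through `t`, because a move ends in a play that she wins, and at least one of them leaves
these plays. So from `λ` on the potential at `t` never turns from true to false, and it turns from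
false to true at least once; it persists at limits, because it depends only on the choices on the
way to `t`. If she wins them all, the situation is reversed. Hence `s_λ` and `s_λ'` choose
differently on the way to `t`, for every large enough `λ'` (`eventually_ne_on_the_way`).

Now let `λ` range over the countable limit ordinals. In both topologies, the choices on the way to
`t` are controlled by one of countably many equivalence relations on profiles whose classes are
neighbourhoods: agreement up to a given depth, or, in a countable tree, agreement on the way to a
given vertex. The limit condition provides `γ < λ` such that `s_γ` is equivalent to `s_λ`. By a
pressing down argument (`exists_same_value_of_regressive`), two ordinals `λ` and `λ'`, with `λ'` as
large as desired compared to `λ`, share the same `γ` and the same equivalence relation, so that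
`s_λ` and `s_λ'` do agree on the way to `t`.
-/

namespace LazyGame

open Order
open scoped Ordinal

/-! ### Countable ordinals -/

theorem exists_upper_bound_lt_omega_one {ι : Type*} [Countable ι] (f : ι → Ordinal.{x})
    (hf : ∀ i, f i < ω₁) : ∃ μ < ω₁, ∀ i, f i ≤ μ :=
  ⟨⨆ i, f i, Ordinal.iSup_lt_omega_one hf, fun i => le_ciSup Ordinal.bddAbove_of_small i⟩

theorem isSuccLimit_omega_one : IsSuccLimit (ω₁ : Ordinal.{x}) := by
  rw [← Cardinal.ord_aleph]
  exact Cardinal.isSuccLimit_ord (Cardinal.aleph0_le_aleph 1)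

theorem countable_Iic_of_lt_omega_one {β : Ordinal.{x}} (hβ : β < ω₁) : Countable (Set.Iic β) := by
  have h : (succ β).card < Cardinal.aleph 1 := by
    rw [← Cardinal.lt_ord, Cardinal.ord_aleph]
    exact isSuccLimit_omega_one.succ_lt hβ
  have h' : (succ β).card ≤ Cardinal.aleph0 := by
    rwa [← Cardinal.succ_aleph0, lt_succ_iff] at h
  rw [← Set.Iio_succ_eq_Iic, ← Cardinal.mk_le_aleph0_iff, Cardinal.mk_Iio_ordinal]
  simpa only [Cardinal.lift_le_aleph0] using h'

theorem exists_closed_limit_lt_omega_one {J : Type*} [Countable J]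
    (F : J → Ordinal.{x} → Ordinal.{x}) (hF : ∀ j, ∀ β < ω₁, F j β < ω₁) :
    ∃ μ < ω₁, IsSuccLimit μ ∧ ∀ β < μ, ∀ j, F j β < μ := by
  have step : ∀ β : Set.Iio (ω₁ : Ordinal.{x}), ∃ μ : Set.Iio (ω₁ : Ordinal.{x}),
      β < μ ∧ ∀ γ ≤ β.1, ∀ j, F j γ < μ.1 := by
    rintro ⟨β, hβ⟩
    have := countable_Iic_of_lt_omega_one hβ
    obtain ⟨μ, hμ, h⟩ := exists_upper_bound_lt_omega_one
      (fun i : J × Set.Iic β => F i.1 i.2.1) (fun i => hF _ _ (i.2.2.trans_lt hβ))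
    refine ⟨⟨succ (max β μ), isSuccLimit_omega_one.succ_lt (max_lt hβ hμ)⟩, ?_, ?_⟩
    · exact (le_max_left β μ).trans_lt (lt_succ _)
    · exact fun γ hγ j => lt_succ_iff.2 ((h ⟨j, γ, hγ⟩).trans (le_max_right _ _))
  choose f hf hF' using step
  let y : ℕ → Set.Iio (ω₁ : Ordinal.{x}) := fun n => f^[n] ⟨0, Ordinal.omega_pos 1⟩
  have hy : ∀ n, y (n + 1) = f (y n) := fun n => Function.iterate_succ_apply' _ _ _
  have hlt : ∀ n, (y n).1 < ⨆ n, (y n).1 := fun n =>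
    (show (y n).1 < (y (n + 1)).1 by rw [hy]; exact hf _).trans_le
      (le_ciSup (f := fun n => (y n).1) Ordinal.bddAbove_of_small (n + 1))
  have hF'' : ∀ β < ⨆ n, (y n).1, ∃ n, β < (y n).1 := fun β hβ => exists_lt_of_lt_ciSup hβ
  refine ⟨⨆ n, (y n).1, Ordinal.iSup_lt_omega_one fun n => (y n).2, ?_, ?_⟩
  · refine ⟨fun h => ?_, ?_⟩
    · exact absurd (hlt 0) h.not_lt
    · rw [isSuccPrelimit_iff_succ_lt]
      intro β hβ
      obtain ⟨n, hn⟩ := hF'' β hβ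
      exact (succ_le_of_lt hn).trans_lt (hlt n)
  · intro β hβ j
    obtain ⟨n, hn⟩ := hF'' β hβ
    refine lt_trans ?_ (hlt (n + 1))
    rw [hy]
    exact hF' _ _ hn.le j

/-- A weak form of the pressing down lemma: a regressive function on the countable limit ordinals,
together with a countable colouring, takes the same value and colour at two ordinals that are far
apart, in the sense prescribed by `δ`. -/
theorem exists_same_value_of_regressive {J : Type*} [Countable J] (j : Ordinal.{x} → J)
    (γ δ : Ordinal.{x} → Ordinal.{x}) (hγ : ∀ l < ω₁, IsSuccLimit l → γ l < l)
    (hδ : ∀ l < ω₁, δ l < ω₁) :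
    ∃ l < ω₁, ∃ l' < ω₁, IsSuccLimit l ∧ IsSuccLimit l' ∧ δ l < l' ∧ j l = j l' ∧ γ l = γ l' := by
  classical
  -- `F i β` is `δ l` for some `l` of colour `i` and value `β`; a limit ordinal that is closed
  -- under `F` is far apart from the `l` chosen for its own colour and value.
  let F : J → Ordinal.{x} → Ordinal.{x} := fun i β =>
    if h : ∃ l < ω₁, IsSuccLimit l ∧ j l = i ∧ γ l = β then δ h.choose else 0
  obtain ⟨μ, hμ, hlim, hcl⟩ := exists_closed_limit_lt_omega_one F (by
    intro i β _
    by_cases h : ∃ l < ω₁, IsSuccLimit l ∧ j l = i ∧ γ l = β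
    · simp only [F, dif_pos h]
      exact hδ _ h.choose_spec.1
    · simp only [F, dif_neg h]
      exact Ordinal.omega_pos 1)
  have h : ∃ l < ω₁, IsSuccLimit l ∧ j l = j μ ∧ γ l = γ μ := ⟨μ, hμ, hlim, rfl, rfl⟩
  have h1 := hcl (γ μ) (hγ μ hμ hlim) (j μ)
  simp only [F, dif_pos h] at h1
  obtain ⟨h2, h3, h4, h5⟩ := h.choose_spec
  exact ⟨_, h2, μ, hμ, h3, hlim, h1, h4, h5⟩

/-! ### Plays -/

section Plays

variable {B : Type v} {T : Descriptive.tree B}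

theorem Play.mem_of_prefix (p : Play T) {t t' : Vertex T} (ht' : t' ∈ p.1) (h : t.1 <+: t'.1) :
    t ∈ p.1 := by
  have hins : IsChain (fun t t' : Vertex T => t.1 <+: t'.1) (insert t p.1) := by
    refine p.2.1.insert fun u hu _ => ?_
    rcases p.2.1.total ht' hu with h1 | h1
    · exact Or.inl (h.trans h1)
    · exact List.prefix_or_prefix_of_prefix h h1
  rw [p.2.2 hins (Set.subset_insert _ _)]
  exact Set.mem_insert _ _

/-- The sets of plays through a vertex of `p` form a neighbourhood basis of `p`. -/
theorem exists_vertex_of_isOpen (hroot : [] ∈ T) {U : Set (Play T)} (hU : IsOpen U) {p : Play T}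
    (hp : p ∈ U) : ∃ t ∈ p.1, ∀ q : Play T, t ∈ q.1 → q ∈ U := by
  induction hU with
  | basic C hC =>
    obtain ⟨t, rfl⟩ := hC
    exact ⟨t, hp, fun q hq => hq⟩
  | univ =>
    have hins : IsChain (fun t t' : Vertex T => t.1 <+: t'.1) (insert ⟨[], hroot⟩ p.1) :=
      p.2.1.insert fun u _ _ => Or.inl List.nil_prefix
    refine ⟨⟨[], hroot⟩, ?_, fun _ _ => trivial⟩
    rw [p.2.2 hins (Set.subset_insert _ _)]
    exact Set.mem_insert _ _
  | inter U V _ _ ihU ihV =>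
    obtain ⟨t, ht, hU⟩ := ihU hp.1
    obtain ⟨t', ht', hV⟩ := ihV hp.2
    rcases p.2.1.total ht ht' with h | h
    · exact ⟨t', ht', fun q hq => ⟨hU q (q.mem_of_prefix hq h), hV q hq⟩⟩
    · exact ⟨t, ht, fun q hq => ⟨hU q hq, hV q (q.mem_of_prefix hq h)⟩⟩
  | sUnion S _ ih =>
    obtain ⟨V, hV, hpV⟩ := hp
    obtain ⟨t, ht, h⟩ := ih V hV hpV
    exact ⟨t, ht, fun q hq => ⟨V, hV, h q hq⟩⟩

/-- A `Δ⁰₂` set is, relative to any non-empty set `P` of plays, everything or nothing near some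
play of `P`. Otherwise, a play that belongs to the set and to its complement could be built as a
limit, since both are countable intersections of open sets. -/
theorem exists_homogeneous_vertex (hroot : [] ∈ T) {W : Set (Play T)} (hW : IsDeltaZeroTwo W)
    {P : Set (Play T)} (hP : P.Nonempty) :
    ∃ t : Vertex T, (∃ p ∈ P, t ∈ p.1) ∧
      ((∀ p ∈ P, t ∈ p.1 → p ∈ W) ∨ (∀ p ∈ P, t ∈ p.1 → p ∉ W)) := by
  by_contra! hcon
  obtain ⟨⟨U, hUo, hWU⟩, C, hCc, hWC⟩ := hW
  have step : ∀ (n : ℕ) (t : {t : Vertex T // ∃ p ∈ P, t ∈ p.1}),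
      ∃ t' : {t : Vertex T // ∃ p ∈ P, t ∈ p.1},
        t.1.1 <+: t'.1.1 ∧ ∀ q : Play T, t'.1 ∈ q.1 → q ∈ U n ∧ q ∉ C n := by
    -- two vertices of the same play have an upper bound among them
    have join : ∀ (p : Play T) (t t' : Vertex T), t ∈ p.1 → t' ∈ p.1 →
        ∃ w ∈ p.1, t.1 <+: w.1 ∧ t'.1 <+: w.1 := by
      intro p t t' ht ht'
      rcases p.2.1.total ht ht' with h | h
      · exact ⟨t', ht', h, List.prefix_rfl⟩
      · exact ⟨t, ht, List.prefix_rfl, h⟩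
    rintro n ⟨t, ht⟩
    obtain ⟨-, p, hp, htp, hpW⟩ := hcon t ht
    obtain ⟨t1, ht1, h1⟩ := exists_vertex_of_isOpen hroot (hUo n)
      (show p ∈ U n from Set.mem_iInter.1 (hWU ▸ hpW) n)
    obtain ⟨t2, ht2, hle, hle'⟩ := join p t t1 htp ht1
    obtain ⟨⟨q, hq, htq, hqW⟩, -⟩ := hcon t2 ⟨p, hp, ht2⟩
    obtain ⟨t3, ht3, h3⟩ := exists_vertex_of_isOpen hroot (hCc n).isOpen_compl
      (show q ∈ (C n)ᶜ from fun h => hqW (hWC ▸ Set.mem_iUnion.2 ⟨n, h⟩))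
    obtain ⟨t4, ht4, hle2, hle3⟩ := join q t2 t3 htq ht3
    exact ⟨⟨t4, q, hq, ht4⟩, hle.trans hle2, fun r hr =>
      ⟨h1 r (r.mem_of_prefix hr (hle'.trans hle2)), h3 r (r.mem_of_prefix hr hle3)⟩⟩
  choose f hf hfUC using step
  obtain ⟨p₀, hp₀⟩ := hP
  obtain ⟨t₀, ht₀, -⟩ := exists_vertex_of_isOpen hroot isOpen_univ (Set.mem_univ p₀)
  let y : ℕ → {t : Vertex T // ∃ p ∈ P, t ∈ p.1} := fun n =>
    Nat.rec ⟨t₀, p₀, hp₀, ht₀⟩ (fun n t => f n t) n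
  have hmono : ∀ m n, m ≤ n → (y m).1.1 <+: (y n).1.1 := fun m n hmn => by
    induction hmn with
    | refl => exact List.prefix_rfl
    | step _ ih => exact ih.trans (hf _ _)
  have hchain : IsChain (fun t t' : Vertex T => t.1 <+: t'.1) (Set.range fun n => (y n).1) := by
    rintro _ ⟨m, rfl⟩ _ ⟨n, rfl⟩ _
    exact (le_total m n).imp (hmono m n) (hmono n m)
  obtain ⟨M, hM, hsub⟩ := hchain.exists_maxChain
  have hq : ∀ n, (⟨M, hM⟩ : Play T) ∈ U n ∧ (⟨M, hM⟩ : Play T) ∉ C n := fun n =>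
    hfUC n (y n) _ (hsub ⟨n + 1, rfl⟩)
  have hin : (⟨M, hM⟩ : Play T) ∈ W := by
    rw [hWU]
    exact Set.mem_iInter.2 fun n => (hq n).1
  rw [hWC] at hin
  obtain ⟨n, hn⟩ := Set.mem_iUnion.1 hin
  exact (hq n).2 hn

/-! ### Deviations of a profile from a vertex -/

/-- `u` lies strictly above `t`, and the edge that `s` chooses at `u` does not lead to `t`. -/
def DeviatesAt (s : Profile T) (t : List B) (u : InternalVertex T) : Prop :=
  ∃ b : B, u.1 ++ [b] <+: t ∧ (s u).1 ≠ b

theorem not_follows_iff {s : Profile T} {t : List B} : ¬ Follows s t ↔ ∃ u, DeviatesAt s t u := by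
  simp only [Follows, DeviatesAt]
  push Not
  rfl

theorem DeviatesAt.length_lt {s : Profile T} {t : List B} {u : InternalVertex T}
    (h : DeviatesAt s t u) : u.1.length < t.length := by
  obtain ⟨b, hb, -⟩ := h
  have := hb.length_le
  simp at this
  omega

theorem DeviatesAt.prefix {s : Profile T} {t : List B} {u : InternalVertex T}
    (h : DeviatesAt s t u) : u.1 <+: t := by
  obtain ⟨b, hb, -⟩ := h
  exact (List.prefix_append _ _).trans hb

theorem DeviatesAt.eq_of_length_eq {s s' : Profile T} {t : List B} {u u' : InternalVertex T}
    (h : DeviatesAt s t u) (h' : DeviatesAt s' t u') (hl : u.1.length = u'.1.length) : u = u' :=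
  Subtype.ext ((List.prefix_of_prefix_length_le h.prefix h'.prefix hl.le).eq_of_length hl)

theorem DeviatesAt.exists_last {s : Profile T} {t : List B} {v : InternalVertex T}
    (hv : DeviatesAt s t v) :
    ∃ u, DeviatesAt s t u ∧ ∀ u', DeviatesAt s t u' → u'.1.length ≤ u.1.length := by
  have hbdd : BddAbove {n | ∃ u, DeviatesAt s t u ∧ u.1.length = n} :=
    ⟨t.length, fun n ⟨u, hu, hn⟩ => hn ▸ hu.length_lt.le⟩
  have hne : {n | ∃ u, DeviatesAt s t u ∧ u.1.length = n}.Nonempty := ⟨_, v, hv, rfl⟩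
  obtain ⟨u, hu, hmax⟩ := Nat.sSup_mem hne hbdd
  exact ⟨u, hu, fun u' hu' => hmax ▸ le_csSup hbdd ⟨u', hu', rfl⟩⟩

end Plays

/-! ### The potential -/

namespace SequentialGame

variable {A : Type u} {B : Type v} {O : Type w} (g : SequentialGame A B O)

/-- The profile `s` does not lead to `t`, and the last vertex on the way to `t` at which it turns
away is owned by `a`. -/
def LastDeviationOwnedBy (a : A) (t : List B) (s : Profile g.tree) : Prop :=
  ∃ u, DeviatesAt s t u ∧ g.owner ⟨u.1, u.2.1⟩ = a ∧
    ∀ u', DeviatesAt s t u' → u'.1.length ≤ u.1.length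

variable {g}

/-- If `s` and `s'` both turn away from `t` at some vertex, then the play induced by `s'` does not
reach beyond it, so that their last deviations coincide. Otherwise each vertex where one of them
turns away from `t` has been changed and is owned by `c`. -/
theorem lastDeviationOwnedBy_lazyConv {a c : A} {s s' : Profile g.tree} (h : g.LazyConv c s s')
    (t : List B) :
    (¬ Follows s t ∧ ¬ Follows s' t ∧
      (g.LastDeviationOwnedBy a t s ↔ g.LastDeviationOwnedBy a t s')) ∨
    ((g.LastDeviationOwnedBy a t s ↔ c = a ∧ ¬ Follows s t) ∧
      (g.LastDeviationOwnedBy a t s' ↔ c = a ∧ ¬ Follows s' t)) := by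
  by_cases hcom : ∃ u, DeviatesAt s t u ∧ DeviatesAt s' t u
  · left
    obtain ⟨u, hu, hu'⟩ := hcom
    refine ⟨not_follows_iff.2 ⟨u, hu⟩, not_follows_iff.2 ⟨u, hu'⟩, ?_⟩
    have hsame : ∀ v : InternalVertex g.tree, v.1 <+: t → u.1.length < v.1.length →
        s v = s' v := by
      intro v hv hlt
      by_contra hne
      obtain ⟨b, hb, hsb⟩ := hu'
      refine hsb ((h v hne).2 u b (List.prefix_of_prefix_length_le hb hv ?_))
      simpa using hlt
    have hiff : ∀ v, u.1.length ≤ v.1.length → (DeviatesAt s t v ↔ DeviatesAt s' t v) := by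
      intro v hle
      rcases hle.lt_or_eq with hlt | heq
      · constructor
        · rintro hd
          have e := hsame v hd.prefix hlt
          simpa only [DeviatesAt, e] using hd
        · rintro hd
          have e := hsame v hd.prefix hlt
          simpa only [DeviatesAt, e] using hd
      · constructor
        · intro hd
          rwa [← hu'.eq_of_length_eq hd heq]
        · intro hd
          rwa [← hu.eq_of_length_eq hd heq]
    have key : ∀ {r r' : Profile g.tree}, DeviatesAt r t u →
        (∀ v, u.1.length ≤ v.1.length → (DeviatesAt r t v ↔ DeviatesAt r' t v)) →
        g.LastDeviationOwnedBy a t r → g.LastDeviationOwnedBy a t r' := by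
      rintro r r' hr hrr' ⟨w, hw, ho, hmax⟩
      have huw := hmax u hr
      refine ⟨w, (hrr' w huw).1 hw, ho, fun v hv => ?_⟩
      by_contra! hlt
      exact absurd (hmax v ((hrr' v (huw.trans hlt.le)).2 hv)) (not_le.2 hlt)
    exact ⟨key hu hiff, key hu' fun v hv => (hiff v hv).symm⟩
  · right
    have hne : ∀ v, DeviatesAt s t v ∨ DeviatesAt s' t v → g.owner ⟨v.1, v.2.1⟩ = c := by
      intro v hv
      refine (h v fun heq => hcom ⟨v, ?_⟩).1
      simp only [DeviatesAt, heq, or_self] at hv ⊢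
      exact ⟨hv, hv⟩
    have key : ∀ r : Profile g.tree, (∀ v, DeviatesAt r t v → g.owner ⟨v.1, v.2.1⟩ = c) →
        (g.LastDeviationOwnedBy a t r ↔ c = a ∧ ¬ Follows r t) := by
      intro r hr
      rw [not_follows_iff]
      constructor
      · rintro ⟨u, hu, ho, -⟩
        exact ⟨(hr u hu).symm.trans ho, u, hu⟩
      · rintro ⟨rfl, v, hv⟩
        obtain ⟨u, hu, hmax⟩ := hv.exists_last
        exact ⟨u, hu, hr u hu, hmax⟩
    exact ⟨key s fun v hv => hne v (Or.inl hv), key s' fun v hv => hne v (Or.inr hv)⟩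

theorem lastDeviationOwnedBy_congr {a : A} {t : List B} {s s' : Profile g.tree}
    (h : ∀ u : InternalVertex g.tree, (∃ b, u.1 ++ [b] <+: t) → s u = s' u) :
    g.LastDeviationOwnedBy a t s ↔ g.LastDeviationOwnedBy a t s' := by
  have hiff : ∀ u, DeviatesAt s t u ↔ DeviatesAt s' t u := by
    intro u
    refine exists_congr fun b => and_congr_right fun hb => ?_
    rw [h u ⟨b, hb⟩]
  simp only [LastDeviationOwnedBy, hiff]

/-! ### Sequences of length `ω₁` -/

/-- If a property persists at successors and, at limits, holds as soon as it holds at all large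
enough earlier times, then it holds from any time on at which it holds. -/
theorem persists_of_step_of_limit {Q : Ordinal.{x} → Prop} {l : Ordinal.{x}}
    (hstep : ∀ β, l ≤ β → β < ω₁ → Q β → Q (succ β))
    (hlim : ∀ β < ω₁, IsSuccLimit β → ∀ β' < β, (∀ γ, β' < γ → γ < β → Q γ) → Q β)
    {β β' : Ordinal.{x}} (hl : l ≤ β) (hβ : Q β) (hle : β ≤ β') (hlt : β' < ω₁) : Q β' := by
  induction β' using Ordinal.limitRecOn with
  | zero =>
    rwa [← nonpos_iff_eq_zero.1 hle]
  | add_one γ ih =>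
    rw [← succ_eq_add_one] at hle hlt ⊢
    rcases hle.lt_or_eq with h | h
    · have hγ := lt_succ_iff.1 h
      have hγ' := (lt_succ γ).trans hlt
      exact hstep γ (hl.trans hγ) hγ' (ih hγ hγ')
    · rwa [← h]
  | limit γ hγ ih =>
    rcases hle.lt_or_eq with h | h
    · exact hlim γ hlt hγ β h fun δ h1 h2 => ih δ h2 h1.le (h2.trans hlt)
    · rwa [← h]

variable {W : A → Set (Play g.tree)}

/-- If player `a` moves at some time `δ ≥ l`, then there is a vertex `t` such that the profile at
time `l` differs from all late enough profiles on the way to `t`. Here `c β` is the player who moves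
at time `β`. -/
theorem eventually_ne_on_the_way (hwin : g.IsWinLose W) {a : A} (hW : IsDeltaZeroTwo (W a))
    {S : Ordinal.{x} → Profile g.tree} {c : Ordinal.{x} → A}
    (hstep : ∀ β < ω₁, g.LazyImprovementOf (c β) (S β) (S (succ β)))
    (hlim : ∀ β < ω₁, IsSuccLimit β → ∀ β' < β, ∀ t : Vertex g.tree, ∃ γ, β' < γ ∧ γ < β ∧
      ∀ u : InternalVertex g.tree, (∃ b, u.1 ++ [b] <+: t.1) → S γ u = S β u)
    {l δ : Ordinal.{x}} (hlδ : l ≤ δ) (hδ : δ < ω₁) (hca : c δ = a) :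
    ∃ (t : Vertex g.tree), ∃ δ' < ω₁, ∀ l', δ' < l' → l' < ω₁ →
      ¬ ∀ u : InternalVertex g.tree, (∃ b, u.1 ++ [b] <+: t.1) → S l u = S l' u := by
  let P : Set (Play g.tree) := {p | ∃ β, l ≤ β ∧ β < ω₁ ∧ c β = a ∧
    (p = inducedPlay (S β) ∨ p = inducedPlay (S (succ β)))}
  obtain ⟨t, ⟨p, ⟨ε, hlε, hε, hcε, hpε⟩, htp⟩, hhom⟩ :=
    exists_homogeneous_vertex g.root_mem hW (P := P) ⟨_, δ, hlδ, hδ, hca, Or.inl rfl⟩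
  have hlose : ∀ β < ω₁, c β = a → inducedPlay (S β) ∉ W a ∧ inducedPlay (S (succ β)) ∈ W a :=
    fun β hβ hc => (hwin a _ _).1 (hc ▸ (hstep β hβ).1)
  -- the potential persists through limits, in both directions
  have hQlim : ∀ β < ω₁, IsSuccLimit β → ∀ β' < β, ∃ γ, β' < γ ∧ γ < β ∧
      (g.LastDeviationOwnedBy a t.1 (S γ) ↔ g.LastDeviationOwnedBy a t.1 (S β)) := by
    intro β hβ hl β' hβ'
    obtain ⟨γ, h1, h2, h3⟩ := hlim β hβ hl β' hβ' t
    exact ⟨γ, h1, h2, lastDeviationOwnedBy_congr h3⟩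
  have hconv := fun β hβ => lastDeviationOwnedBy_lazyConv (a := a) (hstep β hβ).2 t.1
  have hmem : ∀ s : Profile g.tree, Follows s t.1 → ¬ g.LastDeviationOwnedBy a t.1 s :=
    fun s hs ⟨u, hu, _⟩ => not_follows_iff.2 ⟨u, hu⟩ hs
  refine ⟨t, ε, hε, fun l' hl' hl'ω hagree => ?_⟩
  have hQ := lastDeviationOwnedBy_congr (a := a) hagree
  rcases hhom with hhom | hhom
  · -- `a` wins the plays of `P` through `t`, hence she leaves none of them
    have hnot : ∀ β, l ≤ β → β < ω₁ → c β = a → ¬ Follows (S β) t.1 := fun β h1 h2 h3 hf =>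
      (hlose β h2 h3).1 (hhom _ ⟨β, h1, h2, h3, Or.inl rfl⟩ hf)
    have hst : ∀ β, l ≤ β → β < ω₁ → ¬ g.LastDeviationOwnedBy a t.1 (S β) →
        ¬ g.LastDeviationOwnedBy a t.1 (S (succ β)) := by
      intro β h1 h2 h3
      have := hnot β h1 h2
      rcases hconv β h2 with h | h <;> tauto
    have hper := @persists_of_step_of_limit
      (fun β => ¬ g.LastDeviationOwnedBy a t.1 (S β)) l hst (by
        intro β hβ hl β' hβ' hall
        obtain ⟨γ, h1, h2, h3⟩ := hQlim β hβ hl β' hβ'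
        exact fun h => hall γ h1 h2 (h3.2 h))
    have hf : Follows (S (succ ε)) t.1 := by
      rcases hpε with rfl | rfl
      · exact absurd htp (hnot ε hlε hε hcε)
      · exact htp
    have hfalse := hper (hlε.trans (le_succ ε)) (hmem _ hf) (succ_le_of_lt hl') hl'ω
    have htrue : g.LastDeviationOwnedBy a t.1 (S ε) := by
      have := hnot ε hlε hε hcε
      rcases hconv ε hε with h | h <;> tauto
    exact hper le_rfl (fun h => hfalse (hQ.1 h)) hlε hε htrue
  · -- `a` loses the plays of `P` through `t`, hence she reaches none of them
    have hnot : ∀ β, l ≤ β → β < ω₁ → c β = a → ¬ Follows (S (succ β)) t.1 := fun β h1 h2 h3 hf =>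
      hhom _ ⟨β, h1, h2, h3, Or.inr rfl⟩ hf (hlose β h2 h3).2
    have hst : ∀ β, l ≤ β → β < ω₁ → g.LastDeviationOwnedBy a t.1 (S β) →
        g.LastDeviationOwnedBy a t.1 (S (succ β)) := by
      intro β h1 h2 h3
      have := hnot β h1 h2
      rcases hconv β h2 with h | h <;> tauto
    have hper := @persists_of_step_of_limit
      (fun β => g.LastDeviationOwnedBy a t.1 (S β)) l hst (by
        intro β hβ hl β' hβ' hall
        obtain ⟨γ, h1, h2, h3⟩ := hQlim β hβ hl β' hβ'
        exact h3.1 (hall γ h1 h2))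
    have hf : Follows (S ε) t.1 := by
      rcases hpε with rfl | rfl
      · exact htp
      · exact absurd htp (hnot ε hlε hε hcε)
    have htrue : g.LastDeviationOwnedBy a t.1 (S (succ ε)) := by
      have := hnot ε hlε hε hcε
      rcases hconv ε hε with h | h <;> tauto
    have htrue' := hper (hlε.trans (le_succ ε)) htrue (succ_le_of_lt hl') hl'ω
    exact hmem _ hf (hper le_rfl (hQ.2 htrue') hlε hε)

/-- The common part of both topologies: there are countably many equivalence relations `R j`, whose
classes are neighbourhoods, and `R (lev t)` implies agreement on the way to `t`. -/
theorem card_le_aleph0_of_isOrdinalSequence [Finite A] (hwin : g.IsWinLose W)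
    (hW : ∀ a, IsDeltaZeroTwo (W a)) {τ : TopologicalSpace (Profile g.tree)}
    {J : Type*} [Countable J] (lev : Vertex g.tree → J) (R : J → Setoid (Profile g.tree))
    (hR : ∀ j s, {s' | R j s' s} ∈ @nhds _ τ s)
    (hlev : ∀ (t : Vertex g.tree) (s s' : Profile g.tree), R (lev t) s s' →
      ∀ u : InternalVertex g.tree, (∃ b, u.1 ++ [b] <+: t.1) → s u = s' u)
    {α : Ordinal.{x}} {s : Set.Iio α → Profile g.tree}
    (hs : IsOrdinalSequence τ g.LazyImprovement α s) : α.card ≤ Cardinal.aleph0 := by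
  by_contra! hα
  have hω : ω₁ ≤ α := by
    rw [← Cardinal.ord_aleph, Cardinal.ord_le, ← Cardinal.succ_aleph0]
    exact succ_le_of_lt hα
  have hlt : ∀ β, β < ω₁ → β < α := fun β hβ => hβ.trans_le hω
  have hsucc : ∀ β, β < ω₁ → succ β < ω₁ := fun β hβ => isSuccLimit_omega_one.succ_lt hβ
  -- the values of `S` from `ω₁` on do not matter
  let S : Ordinal.{x} → Profile g.tree := fun β =>
    if h : β < ω₁ then s ⟨β, hlt β h⟩ else s ⟨0, hlt 0 (Ordinal.omega_pos 1)⟩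
  have hS : ∀ β (h : β < ω₁), S β = s ⟨β, hlt β h⟩ := fun β h => dif_pos h
  have hstep : ∀ β, ∃ a, β < ω₁ → g.LazyImprovementOf a (S β) (S (succ β)) := by
    intro β
    by_cases hβ : β < ω₁
    · rw [hS β hβ, hS _ (hsucc β hβ)]
      obtain ⟨a, ha⟩ := hs.step ⟨β, hlt β hβ⟩ ⟨succ β, hlt _ (hsucc β hβ)⟩ rfl
      exact ⟨a, fun _ => ha⟩
    · exact ⟨g.owner ⟨[], g.root_mem⟩, fun h => absurd h hβ⟩
  have hlim : ∀ β < ω₁, IsSuccLimit β → ∀ β' < β, ∀ j, ∃ γ, β' < γ ∧ γ < β ∧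
      R j (S γ) (S β) := by
    intro β hβ hl β' hβ' j
    obtain ⟨γ, h1, h2, h3⟩ := hs.limit ⟨β, hlt β hβ⟩ hl ⟨β', hlt _ (hβ'.trans hβ)⟩ hβ' _ (hR j _)
    refine ⟨γ.1, h1, h2, ?_⟩
    rw [hS β hβ, hS γ.1 (lt_trans (show γ.1 < β from h2) hβ)]
    exact h3
  choose c hc using hstep
  obtain ⟨a, ha⟩ : ∃ a, ∀ l < ω₁, ∃ δ, l ≤ δ ∧ δ < ω₁ ∧ c δ = a := by
    by_contra! hcon
    choose l hl h using hcon
    obtain ⟨μ, hμ, hle⟩ := exists_upper_bound_lt_omega_one l hl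
    exact h (c μ) μ (hle _) hμ rfl
  have hmain : ∀ l, ∃ (t : Vertex g.tree) (δ' : Ordinal.{x}), l < ω₁ → δ' < ω₁ ∧
      ∀ l', δ' < l' → l' < ω₁ →
        ¬ ∀ u : InternalVertex g.tree, (∃ b, u.1 ++ [b] <+: t.1) → S l u = S l' u := by
    intro l
    by_cases hl : l < ω₁
    · obtain ⟨δ, h1, h2, h3⟩ := ha l hl
      obtain ⟨t, δ', h4, h5⟩ := eventually_ne_on_the_way hwin (hW a) hc
        (fun β hβ hl β' hβ' t => by
          obtain ⟨γ, h1, h2, h3⟩ := hlim β hβ hl β' hβ' (lev t)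
          exact ⟨γ, h1, h2, hlev t _ _ h3⟩) h1 h2 h3
      exact ⟨t, δ', fun _ => ⟨h4, h5⟩⟩
    · exact ⟨⟨[], g.root_mem⟩, 0, fun h => absurd h hl⟩
  choose t δ' hδ' using hmain
  have hpress : ∀ l, ∃ γ, l < ω₁ → IsSuccLimit l → γ < l ∧ R (lev (t l)) (S γ) (S l) := by
    intro l
    by_cases h : l < ω₁ ∧ IsSuccLimit l
    · obtain ⟨γ, -, h2, h3⟩ := hlim l h.1 h.2 0 (pos_iff_ne_zero.2 fun h0 => h.2.1 (by
        rw [h0]; exact isMin_bot)) (lev (t l))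
      exact ⟨γ, fun _ _ => ⟨h2, h3⟩⟩
    · exact ⟨0, fun h1 h2 => absurd ⟨h1, h2⟩ h⟩
  choose γ hγ using hpress
  obtain ⟨l, hl, l', hl', hll, hll', hlt', hj, heq⟩ := exists_same_value_of_regressive
    (fun l => lev (t l)) γ δ' (fun l h1 h2 => (hγ l h1 h2).1) (fun l h => (hδ' l h).1)
  have h1 := (hγ l hl hll).2
  have h2 := (hγ l' hl' hll').2
  rw [← hj, ← heq] at h2
  exact (hδ' l hl).2 l' hlt' hl' (hlev _ _ _ ((R _).trans' ((R _).symm' h1) h2))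

end SequentialGame

end LazyGame

theorem mainTheorem5 {A : Type u} {B : Type v} {O : Type w} [Finite A]
    (g : LazyGame.SequentialGame A B O) (W : A → Set (LazyGame.Play g.tree))
    (hwin : g.IsWinLose W) (hW : ∀ a : A, LazyGame.IsDeltaZeroTwo (W a)) :
    (∀ (α : Ordinal.{x}) (s : Set.Iio α → LazyGame.Profile g.tree),
      LazyGame.IsOrdinalSequence (LazyGame.depthTopology g.tree) g.LazyImprovement α s →
        α.card ≤ Cardinal.aleph0) ∧
    (Countable (LazyGame.Vertex g.tree) →
      ∀ (α : Ordinal.{x}) (s : Set.Iio α → LazyGame.Profile g.tree),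
        LazyGame.IsOrdinalSequence (LazyGame.pointwiseTopology g.tree) g.LazyImprovement α s →
          α.card ≤ Cardinal.aleph0) := by
  constructor
  · intro α s hs
    refine LazyGame.SequentialGame.card_le_aleph0_of_isOrdinalSequence hwin hW (fun t => t.1.length)
      (fun i => ⟨fun s s' => ∀ t : LazyGame.InternalVertex g.tree, t.1.length ≤ i → s t = s' t,
        fun _ _ _ => rfl, fun h t ht => (h t ht).symm,
        fun h h' t ht => (h t ht).trans (h' t ht)⟩) ?_ ?_ hs
    · intro i s
      let _ := LazyGame.depthTopology g.tree
      have hopen : IsOpen {s' : LazyGame.Profile g.tree |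
          ∀ t : LazyGame.InternalVertex g.tree, t.1.length ≤ i → s' t = s t} :=
        TopologicalSpace.isOpen_generateFrom_of_mem ⟨s, i, rfl⟩
      exact hopen.mem_nhds fun _ _ => rfl
    · rintro t s s' h u ⟨b, hb⟩
      exact h u ((List.prefix_append _ _).trans hb).length_le
  · intro _ α s hs
    refine LazyGame.SequentialGame.card_le_aleph0_of_isOrdinalSequence hwin hW id
      (fun t => ⟨fun s s' => ∀ u : LazyGame.InternalVertex g.tree, u.1 <+: t.1 → s u = s' u,
        fun _ _ _ => rfl, fun h u hu => (h u hu).symm,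
        fun h h' u hu => (h u hu).trans (h' u hu)⟩) ?_ ?_ hs
    · intro t s
      have hfin : {u : LazyGame.InternalVertex g.tree | u.1 <+: t.1}.Finite := by
        refine Set.Finite.of_finite_image (f := Subtype.val)
          ((List.finite_toSet t.1.inits).subset ?_) Subtype.val_injective.injOn
        rintro _ ⟨u, hu, rfl⟩
        exact (List.mem_inits _ _).2 hu
      let _ : ∀ u : LazyGame.InternalVertex g.tree,
          TopologicalSpace {b : B // u.1 ++ [b] ∈ g.tree} := fun _ => ⊥
      have : ∀ u : LazyGame.InternalVertex g.tree,
          DiscreteTopology {b : B // u.1 ++ [b] ∈ g.tree} := fun _ => ⟨rfl⟩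
      refine Filter.mem_of_superset
        (set_pi_mem_nhds hfin fun u _ => (isOpen_discrete {s u}).mem_nhds rfl) ?_
      exact fun s' hs' u hu => hs' u hu
    · rintro t s s' h u ⟨b, hb⟩
      exact h u ((List.prefix_append _ _).trans hb)
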